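/- Let $(W,S)$ be a finite Coxeter group with length function $l$, let $\Gamma$ be a totally ordered abelian group (written additively), and let $L\colon W\to\Gamma$ be a weight function, i.e. $L(ww')=L(w)+L(w')$ whenever $l(ww')=l(w)+l(w')$, with $L(s)>0$ for all $s\in S$. Let $A=\mathbb{Z}[\Gamma]$ be the group ring with basis $\{e^\gamma\mid\gamma\in\Gamma\}$, let $A_{<0}=\langle e^\gamma\mid\gamma<0\rangle_{\mathbb{Z}}$ and let $a\mapsto\bar a$ be the ring involution of $A$ with $\overline{e^\gamma}=e^{-\gamma}$. Let $\mathcal{H}$ be the Iwahori--Hecke algebra of $(W,S,L)$, i.e. the associative $A$-algebra with $A$-basis $\{T_w\mid w\in W\}$, identity $T_1$, and $T_sT_w=T_{sw}$ if $l(sw)>l(w)$, $T_sT_w=T_{sw}+(q_s-q_s^{-1})T_w$ if $l(sw)<l(w)$, where $s\in S$, $w\in W$ and $q_s=e^{L(s)}$. Put $\overline{\sum_w a_wT_w}=\sum_w\bar a_wT_{w^{-1}}^{-1}$, and let $\{\mathbf{C}_w\mid w\in W\}$ be the Kazhdan--Lusztig basis: $\mathbf{C}_w$ is the unique element of $\mathcal{H}$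 with $\overline{\mathbf{C}_w}=\mathbf{C}_w$ and $\mathbf{C}_w-T_w\in\sum_{y\in W}A_{<0}T_y$. Write $\mathbf{C}_x\mathbf{C}_y=\sum_{z}h_{x,y,z}\mathbf{C}_z$ with $h_{x,y,z}\in A$. Let $\le_{\mathcal{L}}$ (respectively $\le_{\mathcal{R}}$) be the reflexive and transitive closure of the relation on $W$ which relates $x$ to $y$ if $h_{s,y,x}\neq0$ (respectively $h_{y,s,x}\ne0$) for some $s\in S$; let $\sim_{\mathcal{L}}$ and $\sim_{\mathcal{R}}$ be the associated equivalence relations, and call the classes of $\sim_{\mathcal{L}}$ left cells. Let $K$ be the field of fractions of $\mathbb{R}[\Gamma]\supseteq A$ and let $\mathcal{H}_K=K\otimes_A\mathcal{H}$. For a left cell $\mathfrak{C}$, let $\chi_{\mathfrak{C}}$ be the character of $\mathcal{H}_K$ afforded by $K\otimes_A[\mathfrak{C}]_A$, where $[\mathfrak{C}]_A$ is the quotient of the left ideal $\langle\mathbf{C}_w\mid w\le_{\mathcal{L}}z\text{ for some }z\in\mathfrak{C}\rangle_A$ by the left ideal $\langle\mathbf{C}_w\mid w\notin\mathfrak{C},\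 w\le_{\mathcal{L}}z\text{ for some }z\in\mathfrak{C}\rangle_A$. Let $\mathfrak{C},\mathfrak{C}_1$ be left cells of $W$ such that $\chi_{\mathfrak{C}}=\chi_{\mathfrak{C}_1}$ is an irreducible character of $\mathcal{H}_K$, and let $\mathfrak{C}\to\mathfrak{C}_1$, $x\mapsto x_1$, be a bijection such that $$h_{w,x,y}=h_{w,x_1,y_1}\qquad\text{for all }w\in W\text{ and all }x,y\in\mathfrak{C}.$$ Then $x\sim_{\mathcal{R}}x_1$ for every $x\in\mathfrak{C}$. -/

import Mathlib

namespace CoxeterSystem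

section Exchange

variable {B W : Type*} [Group W] {M : CoxeterMatrix B} (cs : CoxeterSystem M W)

open Classical in
/-- The signed conjugation action of a simple reflection on `W × ℤ/2`. -/
noncomputable def signedConj (i : B) : Function.End (W × ZMod 2) := fun p =>
  (cs.simple i * p.1 * cs.simple i, p.2 + if p.1 = cs.simple i then 1 else 0)

open Classical in
theorem signedConj_mul_pow (i j : B) (k : ℕ) (t : W) (ε : ZMod 2) :
    ((cs.signedConj i * cs.signedConj j) ^ k : Function.End (W × ZMod 2)) (t, ε) =
      ((cs.simple i * cs.simple j) ^ k * t * ((cs.simple i * cs.simple j) ^ k)⁻¹,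
        ε + ∑ q ∈ Finset.range (2 * k),
          if t = cs.simple j * (cs.simple i * cs.simple j) ^ q then 1 else 0) := by
  have hinv : ∀ p : ℕ, ((cs.simple i * cs.simple j) ^ p)⁻¹ * cs.simple j =
      cs.simple j * (cs.simple i * cs.simple j) ^ p := by
    intro p
    induction p with
    | zero => simp
    | succ p ih =>
      rw [pow_succ', mul_inv_rev, mul_assoc, mul_inv_rev, cs.inv_simple, cs.inv_simple,
        show cs.simple j * cs.simple i * cs.simple j = cs.simple j * (cs.simple i * cs.simple j)
          from mul_assoc _ _ _, ← mul_assoc, ih, mul_assoc, ← pow_succ, ← pow_succ']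
  induction k with
  | zero =>
    simp
    rfl
  | succ k ih =>
    rw [pow_succ']
    change (cs.signedConj i) ((cs.signedConj j)
      (((cs.signedConj i * cs.signedConj j) ^ k : Function.End (W × ZMod 2)) (t, ε))) = _
    rw [ih]
    simp only [signedConj]
    rw [show 2 * (k + 1) = 2 * k + 1 + 1 by ring, Finset.sum_range_succ, Finset.sum_range_succ]
    set r := cs.simple i * cs.simple j with hr
    have e1 : (r ^ k * t * (r ^ k)⁻¹ = cs.simple j) ↔ t = cs.simple j * r ^ (2 * k) := by
      rw [mul_inv_eq_iff_eq_mul, ← eq_inv_mul_iff_mul_eq, ← mul_assoc, hinv, mul_assoc, ← pow_add,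
        two_mul]
    have e2 : (cs.simple j * (r ^ k * t * (r ^ k)⁻¹) * cs.simple j = cs.simple i) ↔
        t = cs.simple j * r ^ (2 * k + 1) := by
      have : (cs.simple j * (r ^ k * t * (r ^ k)⁻¹) * cs.simple j = cs.simple i) ↔
          r ^ k * t * (r ^ k)⁻¹ = cs.simple j * r := by
        constructor
        · intro h
          have h2 := congrArg (fun z => cs.simple j * z * cs.simple j) h
          simpa [mul_assoc, hr] using h2
        · intro h
          rw [h, hr]
          simp [mul_assoc]
      rw [this, mul_inv_eq_iff_eq_mul, ← eq_inv_mul_iff_mul_eq, ← mul_assoc, ← mul_assoc, hinv,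
        mul_assoc, mul_assoc, ← pow_succ', ← pow_add]
      ring_nf
    simp only [e1, e2]
    refine Prod.ext ?_ ?_
    · simp only [pow_succ', hr, mul_inv_rev, cs.inv_simple, mul_assoc]
    · simp only [add_assoc]

theorem signedConj_isLiftable : M.IsLiftable cs.signedConj := by
  classical
  intro i j
  funext p
  obtain ⟨t, ε⟩ := p
  rw [signedConj_mul_pow]
  have h1 : (cs.simple i * cs.simple j) ^ M i j = 1 := cs.simple_mul_simple_pow i j
  rw [h1, two_mul, Finset.sum_range_add]
  simp only [pow_add, h1, one_mul]
  rw [CharTwo.add_self_eq_zero]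
  simp only [inv_one, mul_one, add_zero]
  rfl

/-- The signed conjugation action of `W` on `W × ℤ/2`. -/
noncomputable def signedConjHom : W →* Function.End (W × ZMod 2) :=
  cs.lift ⟨cs.signedConj, cs.signedConj_isLiftable⟩

theorem signedConjHom_wordProd (ω : List B) (t : W) :
    ∃ n : ZMod 2, (∀ ε, cs.signedConjHom (cs.wordProd ω) (t, ε) =
      (cs.wordProd ω * t * (cs.wordProd ω)⁻¹, ε + n)) ∧ (n ≠ 0 → t ∈ cs.rightInvSeq ω) := by
  classical
  induction ω with
  | nil => exact ⟨0, by intro ε; simp; rfl, by simp⟩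
  | cons i ω ih =>
    obtain ⟨n, h1, h2⟩ := ih
    refine ⟨n + if cs.wordProd ω * t * (cs.wordProd ω)⁻¹ = cs.simple i then 1 else 0, ?_, ?_⟩
    · intro ε
      rw [wordProd_cons, map_mul]
      change cs.signedConjHom (cs.simple i) (cs.signedConjHom (cs.wordProd ω) (t, ε)) = _
      rw [h1, signedConjHom, lift_apply_simple]
      simp only [signedConj, mul_inv_rev, cs.inv_simple, mul_assoc, add_assoc]
    · intro hn
      rw [rightInvSeq, List.mem_cons]
      by_cases h : cs.wordProd ω * t * (cs.wordProd ω)⁻¹ = cs.simple i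
      · left
        rw [← h]; group
      · right
        apply h2
        simpa [h] using hn

/-- The parity of an element `t` with respect to `w`. -/
noncomputable def invParity (w t : W) : ZMod 2 := (cs.signedConjHom w (t, 0)).2

theorem signedConjHom_apply (w t : W) (ε : ZMod 2) :
    cs.signedConjHom w (t, ε) = (w * t * w⁻¹, ε + cs.invParity w t) := by
  obtain ⟨ω, rfl⟩ := cs.wordProd_surjective w
  obtain ⟨n, h1, -⟩ := cs.signedConjHom_wordProd ω t
  rw [invParity, h1, h1, zero_add]

theorem invParity_mul (w v t : W) :
    cs.invParity (w * v) t = cs.invParity v t + cs.invParity w (v * t * v⁻¹) := by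
  have : cs.signedConjHom (w * v) (t, 0) = cs.signedConjHom w (cs.signedConjHom v (t, 0)) := by
    rw [map_mul]; rfl
  rw [signedConjHom_apply, signedConjHom_apply, signedConjHom_apply] at this
  simpa using congrArg Prod.snd this

open Classical in
theorem invParity_simple (i : B) (t : W) :
    cs.invParity (cs.simple i) t = if t = cs.simple i then 1 else 0 := by
  rw [invParity, signedConjHom, lift_apply_simple]
  simp [signedConj]

theorem length_lt_of_invParity_ne_zero (w : W) (j : B) (h : cs.invParity w (cs.simple j) ≠ 0) :
    cs.length (w * cs.simple j) < cs.length w := by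
  obtain ⟨ω, hω, rfl⟩ := cs.exists_isReduced w
  obtain ⟨n, h1, h2⟩ := cs.signedConjHom_wordProd ω (cs.simple j)
  rw [invParity, h1, zero_add] at h
  exact (cs.isRightInversion_of_mem_rightInvSeq hω (h2 h)).2

theorem isRightDescent_iff_invParity (w : W) (j : B) :
    cs.IsRightDescent w j ↔ cs.invParity w (cs.simple j) ≠ 0 := by
  refine ⟨fun h h0 => ?_, cs.length_lt_of_invParity_ne_zero w j⟩
  have : cs.invParity (w * cs.simple j) (cs.simple j) ≠ 0 := by
    classical
    rw [invParity_mul, invParity_simple]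
    simp [h0]
  have := cs.length_lt_of_invParity_ne_zero _ _ this
  rw [mul_assoc, cs.simple_mul_simple_self, mul_one] at this
  exact lt_asymm h this

/-- A consequence of the exchange condition. -/
theorem isRightDescent_simple_mul_iff (w : W) (i j : B)
    (h : cs.simple i * w ≠ w * cs.simple j) :
    cs.IsRightDescent (cs.simple i * w) j ↔ cs.IsRightDescent w j := by
  classical
  rw [isRightDescent_iff_invParity, isRightDescent_iff_invParity, invParity_mul, invParity_simple,
    if_neg, add_zero]
  intro h'
  exact h (by rw [← h']; group)

theorem isLeftDescent_mul_simple_iff (w : W) (i j : B)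
    (h : cs.simple i * w ≠ w * cs.simple j) :
    cs.IsLeftDescent (w * cs.simple j) i ↔ cs.IsLeftDescent w i := by
  rw [← isRightDescent_inv_iff, ← isRightDescent_inv_iff, mul_inv_rev, cs.inv_simple]
  refine cs.isRightDescent_simple_mul_iff w⁻¹ j i fun h' => h ?_
  simpa using (congrArg (·⁻¹) h').symm

end Exchange

end CoxeterSystem

/-! ### Coefficients and weight functions -/

/-- The group ring `A = ℤ[Γ]` of an additive abelian group `Γ`; the basis element `e^γ` is
`AddMonoidAlgebra.single γ 1`, and `a.coeff γ` is the coefficient of `e^γ` in `a`. -/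
abbrev CoeffRing (Γ : Type*) : Type _ := AddMonoidAlgebra ℤ Γ

namespace CoeffRing

variable {Γ : Type*} [AddCommGroup Γ]

/-- The ring involution `a ↦ ā` of `ℤ[Γ]` with `e^γ ↦ e^{-γ}`. -/
noncomputable def conj : CoeffRing Γ →+* CoeffRing Γ :=
  AddMonoidAlgebra.mapDomainRingHom ℤ (negAddMonoidHom : Γ →+ Γ)

/-- `A_{<0}`, the subgroup of `ℤ[Γ]` spanned by the `e^γ` with `γ < 0`. -/
def neg (Γ : Type*) [AddCommGroup Γ] [LinearOrder Γ] : AddSubgroup (CoeffRing Γ) where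
  carrier := {a | ∀ γ, a.coeff γ ≠ 0 → γ < 0}
  zero_mem' := by simp
  add_mem' := by
    intro a b ha hb γ h
    by_cases h1 : a.coeff γ = 0
    · exact hb γ (by simpa [h1] using h)
    · exact ha γ h1
  neg_mem' := by
    intro a ha γ h
    exact ha γ (by simpa using h)

theorem conj_single (γ : Γ) (n : ℤ) :
    conj (AddMonoidAlgebra.single γ n) = AddMonoidAlgebra.single (-γ) n := by
  simp [conj]

theorem coeff_conj (a : CoeffRing Γ) (γ : Γ) : (conj a).coeff γ = a.coeff (-γ) := by
  simp only [conj, AddMonoidAlgebra.mapDomainRingHom]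
  change (Finsupp.mapDomain (fun γ : Γ => -γ) a.coeff) γ = _
  conv_lhs => rw [← neg_neg γ]
  exact Finsupp.mapDomain_apply neg_injective _ _

theorem conj_conj (a : CoeffRing Γ) : conj (conj a) = a := by
  ext γ
  simp [coeff_conj]

/-- An element of `A_{<0}` fixed by the involution is zero. -/
theorem eq_zero_of_conj_eq [LinearOrder Γ] [IsOrderedAddMonoid Γ] {a : CoeffRing Γ} (ha : a ∈ neg Γ) (h : conj a = a) : a = 0 := by
  ext γ
  by_contra h0
  have h1 : γ < 0 := ha γ h0
  have h2 : -γ < 0 := ha (-γ) (by rw [← coeff_conj, h]; exact h0)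
  exact lt_asymm h1 (by simpa using h2)

/-- An element `a` with `ā = -a` has the form `b - b̄` with `b ∈ A_{<0}`. -/
theorem exists_sub_conj [LinearOrder Γ] [IsOrderedAddMonoid Γ] {a : CoeffRing Γ} (h : conj a = -a) :
    ∃ b ∈ neg Γ, a = b - conj b := by
  classical
  refine ⟨.ofCoeff (a.coeff.filter (· < 0)), ?_, ?_⟩
  · intro γ hγ
    by_contra h0
    exact hγ (Finsupp.filter_apply_neg _ _ h0)
  · ext γ
    have hc : a.coeff (-γ) = -a.coeff γ := by
      rw [← coeff_conj, h]; simp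
    rw [AddMonoidAlgebra.coeff_sub, Finsupp.sub_apply, coeff_conj]
    simp only [Finsupp.filter_apply, hc]
    rcases lt_trichotomy γ 0 with h1 | h1 | h1
    · simp [h1, h1.asymm]
    · subst h1
      simp at hc ⊢
      omega
    · simp [h1, h1.asymm]

end CoeffRing

namespace CoxeterSystem

/-- A weight function on a Coxeter group with values in a totally ordered abelian group `Γ`,
strictly positive on the simple reflections. -/
structure WeightFunction {B W : Type*} [Group W] {M : CoxeterMatrix B} (cs : CoxeterSystem M W)
    (Γ : Type*) [AddCommGroup Γ] [LinearOrder Γ] where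
  /-- The underlying function. -/
  toFun : W → Γ
  toFun_mul : ∀ w w' : W, cs.length (w * w') = cs.length w + cs.length w' →
    toFun (w * w') = toFun w + toFun w'
  pos : ∀ i : B, 0 < toFun (cs.simple i)

namespace WeightFunction

variable {B W Γ : Type*} [Group W] {M : CoxeterMatrix B} {cs : CoxeterSystem M W}
  [AddCommGroup Γ] [LinearOrder Γ] (L : cs.WeightFunction Γ)

/-- The parameter `q_s = e^{L(s)}`. -/
noncomputable def q (i : B) : CoeffRing Γ := AddMonoidAlgebra.single (L.toFun (cs.simple i)) 1

/-- The inverse `q_s⁻¹ = e^{-L(s)}` of the parameter. -/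
noncomputable def qInv (i : B) : CoeffRing Γ :=
  AddMonoidAlgebra.single (-L.toFun (cs.simple i)) 1

open Classical in
/-- The defining relations of the Iwahori–Hecke algebra on generators `T_w` (`w ∈ W`). -/
inductive HeckeRel : FreeAlgebra (CoeffRing Γ) W → FreeAlgebra (CoeffRing Γ) W → Prop
  | one : HeckeRel (FreeAlgebra.ι _ 1) 1
  | simple_mul (i : B) (w : W) : HeckeRel
      (FreeAlgebra.ι _ (cs.simple i) * FreeAlgebra.ι _ w)
      (if cs.length w < cs.length (cs.simple i * w) then FreeAlgebra.ι _ (cs.simple i * w)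
        else FreeAlgebra.ι _ (cs.simple i * w) + (L.q i - L.qInv i) • FreeAlgebra.ι _ w)

/-- The generic Iwahori–Hecke algebra `ℋ(W,S,L)` over `A = ℤ[Γ]`: it is generated by the `T_w`
subject to `T_1 = 1` and the rule for `T_s T_w`. The `T_w` form an `A`-basis, see `basisT`. -/
def Hecke : Type _ := RingQuot (HeckeRel L)

noncomputable instance : Ring (Hecke L) := inferInstanceAs (Ring (RingQuot (HeckeRel L)))

noncomputable instance : Algebra (CoeffRing Γ) (Hecke L) :=
  inferInstanceAs (Algebra (CoeffRing Γ) (RingQuot (HeckeRel L)))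

/-- The standard basis element `T_w`. -/
noncomputable def T (w : W) : Hecke L :=
  RingQuot.mkAlgHom (CoeffRing Γ) (HeckeRel L) (FreeAlgebra.ι _ w)

theorem T_one : L.T 1 = 1 := by
  rw [T, RingQuot.mkAlgHom_rel (CoeffRing Γ) (HeckeRel.one (L := L)), map_one]
  rfl

theorem T_simple_mul_of_lt {i : B} {w : W} (h : cs.length w < cs.length (cs.simple i * w)) :
    L.T (cs.simple i) * L.T w = L.T (cs.simple i * w) := by
  have := RingQuot.mkAlgHom_rel (CoeffRing Γ) (HeckeRel.simple_mul (L := L) i w)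
  rw [map_mul, if_pos h] at this
  exact this

theorem T_simple_mul_of_gt {i : B} {w : W} (h : cs.length (cs.simple i * w) < cs.length w) :
    L.T (cs.simple i) * L.T w = L.T (cs.simple i * w) + (L.q i - L.qInv i) • L.T w := by
  have := RingQuot.mkAlgHom_rel (CoeffRing Γ) (HeckeRel.simple_mul (L := L) i w)
  rw [map_mul, if_neg h.asymm, map_add, map_smul] at this
  exact this

end WeightFunction

end CoxeterSystem

namespace CoxeterSystem.WeightFunction

section Basis

variable {B W Γ : Type*} [Group W] {M : CoxeterMatrix B} {cs : CoxeterSystem M W}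
  [AddCommGroup Γ] [LinearOrder Γ] (L : cs.WeightFunction Γ)

theorem toFun_simple_eq {i j : B} {w : W} (h : cs.simple i * w = w * cs.simple j) :
    L.toFun (cs.simple i) = L.toFun (cs.simple j) := by
  rcases cs.length_simple_mul w i with h1 | h1
  · have h2 := L.toFun_mul (cs.simple i) w (by rw [h1, cs.length_simple]; omega)
    have h3 := L.toFun_mul w (cs.simple j) (by rw [← h, h1, cs.length_simple])
    rw [← h, h2, add_comm] at h3
    exact add_left_cancel h3
  · have h2 := L.toFun_mul (cs.simple i) (cs.simple i * w)
      (by rw [cs.simple_mul_simple_cancel_left, cs.length_simple]; omega)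
    have h3 := L.toFun_mul (w * cs.simple j) (cs.simple j)
      (by rw [cs.simple_mul_simple_cancel_right, cs.length_simple, ← h]; omega)
    rw [cs.simple_mul_simple_cancel_left] at h2
    rw [cs.simple_mul_simple_cancel_right, ← h, add_comm] at h3
    exact add_right_cancel (h2.symm.trans h3)

open Classical in
/-- Left multiplication by `T_s` on the free module with basis `W`. -/
noncomputable def leftOp (i : B) : Module.End (CoeffRing Γ) (W →₀ CoeffRing Γ) :=
  Finsupp.linearCombination (CoeffRing Γ) fun w => Finsupp.single (cs.simple i * w) 1 +
    (if cs.IsLeftDescent w i then L.q i - L.qInv i else 0) • Finsupp.single w 1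

open Classical in
/-- Right multiplication by `T_s` on the free module with basis `W`. -/
noncomputable def rightOp (i : B) : Module.End (CoeffRing Γ) (W →₀ CoeffRing Γ) :=
  Finsupp.linearCombination (CoeffRing Γ) fun w => Finsupp.single (w * cs.simple i) 1 +
    (if cs.IsRightDescent w i then L.q i - L.qInv i else 0) • Finsupp.single w 1

open Classical in
theorem leftOp_single (i : B) (w : W) : L.leftOp i (Finsupp.single w 1) =
    Finsupp.single (cs.simple i * w) 1 +
    (if cs.IsLeftDescent w i then L.q i - L.qInv i else 0) • Finsupp.single w 1 := by
  rw [leftOp, Finsupp.linearCombination_single, one_smul]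

open Classical in
theorem rightOp_single (i : B) (w : W) : L.rightOp i (Finsupp.single w 1) =
    Finsupp.single (w * cs.simple i) 1 +
    (if cs.IsRightDescent w i then L.q i - L.qInv i else 0) • Finsupp.single w 1 := by
  rw [rightOp, Finsupp.linearCombination_single, one_smul]

theorem leftOp_mul_rightOp (i j : B) : L.leftOp i * L.rightOp j = L.rightOp j * L.leftOp i := by
  classical
  refine Finsupp.lhom_ext' fun w => LinearMap.ext_ring ?_
  simp only [LinearMap.comp_apply, Finsupp.lsingle_apply, Module.End.mul_apply]
  have e1 : L.leftOp i (L.rightOp j (Finsupp.single w 1)) =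
      Finsupp.single (cs.simple i * w * cs.simple j) 1 +
      (if cs.IsLeftDescent (w * cs.simple j) i then L.q i - L.qInv i else 0) •
        Finsupp.single (w * cs.simple j) 1 +
      (if cs.IsRightDescent w j then L.q j - L.qInv j else 0) •
        (Finsupp.single (cs.simple i * w) 1 +
          (if cs.IsLeftDescent w i then L.q i - L.qInv i else 0) • Finsupp.single w 1) := by
    rw [rightOp_single, _root_.map_add, _root_.map_smul, leftOp_single, leftOp_single, ← mul_assoc]
  have e2 : L.rightOp j (L.leftOp i (Finsupp.single w 1)) =
      Finsupp.single (cs.simple i * w * cs.simple j) 1 +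
      (if cs.IsRightDescent (cs.simple i * w) j then L.q j - L.qInv j else 0) •
        Finsupp.single (cs.simple i * w) 1 +
      (if cs.IsLeftDescent w i then L.q i - L.qInv i else 0) •
        (Finsupp.single (w * cs.simple j) 1 +
          (if cs.IsRightDescent w j then L.q j - L.qInv j else 0) • Finsupp.single w 1) := by
    rw [leftOp_single, _root_.map_add, _root_.map_smul, rightOp_single, rightOp_single]
  rw [e1, e2]
  clear e1 e2
  by_cases h : cs.simple i * w = w * cs.simple j
  · have hq : L.q i - L.qInv i = L.q j - L.qInv j := by rw [q, q, qInv, qInv, L.toFun_simple_eq h]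
    have h1 : cs.IsLeftDescent w i ↔ cs.IsRightDescent w j := by
      rw [IsLeftDescent, IsRightDescent, h]
    have h2 : cs.IsLeftDescent (w * cs.simple j) i ↔ ¬ cs.IsRightDescent w j := by
      rw [← h1, ← h, cs.isLeftDescent_iff_not_isLeftDescent_mul (w := w), not_not]
    have h3 : cs.IsRightDescent (cs.simple i * w) j ↔ ¬ cs.IsRightDescent w j := by
      rw [h, cs.isRightDescent_iff_not_isRightDescent_mul (w := w), not_not]
    rw [if_congr h2 rfl rfl, if_congr h3 rfl rfl, if_congr h1 rfl rfl, hq, ← h]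
  · rw [if_congr (cs.isLeftDescent_mul_simple_iff w i j h) rfl rfl,
      if_congr (cs.isRightDescent_simple_mul_iff w i j h) rfl rfl, smul_add, smul_add, smul_smul,
      smul_smul, mul_comm (if cs.IsLeftDescent w i then L.q i - L.qInv i else 0)]
    abel

/-- Two operators commuting with all right multiplications agree if they agree on `1`. -/
theorem op_ext {f g : Module.End (CoeffRing Γ) (W →₀ CoeffRing Γ)}
    (hf : ∀ j, f * L.rightOp j = L.rightOp j * f) (hg : ∀ j, g * L.rightOp j = L.rightOp j * g)
    (h : f (Finsupp.single 1 1) = g (Finsupp.single 1 1)) : f = g := by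
  classical
  refine Finsupp.lhom_ext' fun w => LinearMap.ext_ring ?_
  simp only [LinearMap.comp_apply, Finsupp.lsingle_apply]
  induction hn : cs.length w generalizing w with
  | zero => rw [cs.length_eq_zero_iff.mp hn, h]
  | succ n ih =>
    obtain ⟨j, hj⟩ := cs.exists_rightDescent_of_ne_one
      (w := w) (by rintro rfl; simp at hn)
    have hl : cs.length (w * cs.simple j) = n := by
      have := cs.isRightDescent_iff.mp hj
      omega
    have hw : Finsupp.single w (1 : CoeffRing Γ) =
        L.rightOp j (Finsupp.single (w * cs.simple j) 1) := by
      rw [rightOp_single, cs.simple_mul_simple_cancel_right,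
        if_neg (cs.isRightDescent_iff_not_isRightDescent_mul.mp hj), zero_smul, add_zero]
    rw [hw, ← Module.End.mul_apply, hf, ← Module.End.mul_apply, hg, Module.End.mul_apply,
      Module.End.mul_apply, ih _ hl]

/-- There is an operator commuting with right multiplications that sends `1` to `w`. -/
theorem exists_op (w : W) : ∃ f : Module.End (CoeffRing Γ) (W →₀ CoeffRing Γ),
    (∀ j, f * L.rightOp j = L.rightOp j * f) ∧
      f (Finsupp.single 1 1) = Finsupp.single w 1 := by
  classical
  induction hn : cs.length w generalizing w with
  | zero => exact ⟨1, fun j => by simp, by rw [cs.length_eq_zero_iff.mp hn]; rfl⟩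
  | succ n ih =>
    obtain ⟨i, hi⟩ := cs.exists_leftDescent_of_ne_one
      (w := w) (by rintro rfl; simp at hn)
    have hl : cs.length (cs.simple i * w) = n := by
      have := cs.isLeftDescent_iff.mp hi
      omega
    obtain ⟨f, hf, hf1⟩ := ih _ hl
    refine ⟨L.leftOp i * f, fun j => ?_, ?_⟩
    · rw [mul_assoc, hf, ← mul_assoc, leftOp_mul_rightOp, mul_assoc]
    · rw [Module.End.mul_apply, hf1, leftOp_single, cs.simple_mul_simple_cancel_left,
        if_neg (cs.isLeftDescent_iff_not_isLeftDescent_mul.mp hi), zero_smul, add_zero]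

/-- The operator of left multiplication by `T_w`. -/
noncomputable def op (w : W) : Module.End (CoeffRing Γ) (W →₀ CoeffRing Γ) :=
  (L.exists_op w).choose

theorem op_comm (w : W) (j : B) : L.op w * L.rightOp j = L.rightOp j * L.op w :=
  (L.exists_op w).choose_spec.1 j

theorem op_single_one (w : W) : L.op w (Finsupp.single 1 1) = Finsupp.single w 1 :=
  (L.exists_op w).choose_spec.2

theorem op_one : L.op 1 = 1 :=
  L.op_ext (L.op_comm 1) (by simp) (by rw [op_single_one]; rfl)

theorem op_simple (i : B) : L.op (cs.simple i) = L.leftOp i := by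
  classical
  refine L.op_ext (L.op_comm _) (L.leftOp_mul_rightOp i) ?_
  rw [op_single_one, leftOp_single, mul_one, if_neg (cs.not_isLeftDescent_one i), zero_smul,
    add_zero]

open Classical in
theorem op_simple_mul (i : B) (w : W) : L.op (cs.simple i) * L.op w =
    if cs.length w < cs.length (cs.simple i * w) then L.op (cs.simple i * w)
      else L.op (cs.simple i * w) + (L.q i - L.qInv i) • L.op w := by
  refine L.op_ext (fun j => ?_) (fun j => ?_) ?_
  · rw [mul_assoc, op_comm, ← mul_assoc, op_comm, mul_assoc]
  · split_ifs
    · exact L.op_comm _ j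
    · rw [add_mul, mul_add, op_comm, smul_mul_assoc, mul_smul_comm, op_comm]
  · rw [Module.End.mul_apply, op_single_one, op_simple, leftOp_single]
    rcases cs.length_simple_mul w i with h | h
    · rw [if_neg (by rw [IsLeftDescent]; omega), if_pos (by omega), zero_smul, add_zero,
        op_single_one]
    · rw [if_pos (by rw [IsLeftDescent]; omega), if_neg (by omega), LinearMap.add_apply,
        LinearMap.smul_apply, op_single_one, op_single_one]

/-- The action of the Hecke algebra on the free module with basis `W`. -/
noncomputable def regRep : Hecke L →ₐ[CoeffRing Γ] Module.End (CoeffRing Γ) (W →₀ CoeffRing Γ) :=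
  RingQuot.liftAlgHom (CoeffRing Γ) ⟨FreeAlgebra.lift (CoeffRing Γ) L.op, by
    classical
    intro x y h
    cases h with
    | one => simp [op_one]
    | simple_mul i w =>
      rw [map_mul, FreeAlgebra.lift_ι_apply, FreeAlgebra.lift_ι_apply, op_simple_mul]
      split_ifs
      · rw [FreeAlgebra.lift_ι_apply]
      · rw [_root_.map_add, _root_.map_smul, FreeAlgebra.lift_ι_apply, FreeAlgebra.lift_ι_apply]⟩

theorem regRep_T (w : W) : L.regRep (L.T w) = L.op w := by
  rw [regRep, T]
  exact (RingQuot.liftAlgHom_mkAlgHom_apply (CoeffRing Γ) _ _ _).trans (by simp)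

/-- Induction principle: an additive set containing `1` and closed under `A` and left
multiplication by all `T_s` is everything. -/
theorem hecke_eq_top (N : Submodule (CoeffRing Γ) (Hecke L)) (h1 : (1 : Hecke L) ∈ N)
    (hs : ∀ i, ∀ x ∈ N, L.T (cs.simple i) * x ∈ N) : N = ⊤ := by
  have hT : ∀ w : W, ∀ x ∈ N, L.T w * x ∈ N := by
    intro w
    induction hn : cs.length w generalizing w with
    | zero => intro x hx; rwa [cs.length_eq_zero_iff.mp hn, T_one, one_mul]
    | succ n ih =>
      intro x hx
      obtain ⟨i, hi⟩ := cs.exists_leftDescent_of_ne_one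
        (w := w) (by rintro rfl; simp at hn)
      have hl : cs.length (cs.simple i * w) = n := by
        have := cs.isLeftDescent_iff.mp hi
        omega
      have := L.T_simple_mul_of_lt (i := i) (w := cs.simple i * w)
        (by rw [cs.simple_mul_simple_cancel_left]; omega)
      rw [cs.simple_mul_simple_cancel_left] at this
      rw [← this, mul_assoc]
      exact hs i _ (ih _ hl x hx)
  have key : ∀ a : FreeAlgebra (CoeffRing Γ) W, ∀ x ∈ N,
      (show Hecke L from RingQuot.mkAlgHom (CoeffRing Γ) (HeckeRel L) a) * x ∈ N := by
    intro a
    induction a using FreeAlgebra.induction with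
    | grade0 r =>
      intro x hx
      rw [AlgHom.commutes]
      have := N.smul_mem r hx
      rwa [Algebra.smul_def] at this
    | grade1 w => exact hT w
    | mul a b ha hb =>
      intro x hx
      rw [map_mul]
      exact (mul_assoc (G := Hecke L) _ _ _).symm ▸ ha _ (hb x hx)
    | add a b ha hb =>
      intro x hx
      rw [_root_.map_add]
      exact (add_mul (R := Hecke L) _ _ _).symm ▸ N.add_mem (ha x hx) (hb x hx)
  rw [eq_top_iff]
  intro y _
  obtain ⟨a, rfl⟩ := RingQuot.mkAlgHom_surjective (CoeffRing Γ) (HeckeRel L) y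
  have := key a 1 h1
  rwa [mul_one] at this

/-- The linear map `e_w ↦ T_w`. -/
noncomputable def toHecke : (W →₀ CoeffRing Γ) →ₗ[CoeffRing Γ] Hecke L :=
  Finsupp.linearCombination (CoeffRing Γ) L.T

theorem toHecke_single (w : W) : L.toHecke (Finsupp.single w 1) = L.T w := by
  rw [toHecke, Finsupp.linearCombination_single, one_smul]

theorem toHecke_leftOp (i : B) (x : W →₀ CoeffRing Γ) :
    L.toHecke (L.leftOp i x) = L.T (cs.simple i) * L.toHecke x := by
  classical
  induction x using Finsupp.induction_linear with
  | zero => simp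
  | add x y hx hy => rw [_root_.map_add, _root_.map_add, _root_.map_add, hx, hy, mul_add]
  | single w a =>
    rw [← mul_one a, ← smul_eq_mul, ← Finsupp.smul_single, _root_.map_smul, _root_.map_smul,
      _root_.map_smul, leftOp_single, _root_.map_add, _root_.map_smul, toHecke_single,
      toHecke_single, mul_smul_comm]
    congr 1
    rcases cs.length_simple_mul w i with h | h
    · rw [if_neg (by rw [IsLeftDescent]; omega), T_simple_mul_of_lt _ (by omega), zero_smul,
        add_zero]
    · rw [if_pos (by rw [IsLeftDescent]; omega), T_simple_mul_of_gt _ (by omega)]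

theorem toHecke_bijective : Function.Bijective L.toHecke := by
  constructor
  · have : ∀ x, L.regRep (L.toHecke x) (Finsupp.single 1 1) = x := by
      intro x
      induction x using Finsupp.induction_linear with
      | zero => simp
      | add x y hx hy => rw [_root_.map_add, _root_.map_add, LinearMap.add_apply, hx, hy]
      | single w a =>
        rw [← mul_one a, ← smul_eq_mul, ← Finsupp.smul_single, _root_.map_smul, _root_.map_smul,
          LinearMap.smul_apply, toHecke_single, regRep_T, op_single_one]
    exact Function.LeftInverse.injective (g := fun h => L.regRep h (Finsupp.single 1 1)) this
  · rw [← LinearMap.range_eq_top]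
    refine L.hecke_eq_top _ ⟨Finsupp.single 1 1, by rw [toHecke_single, T_one]⟩ ?_
    rintro i _ ⟨x, rfl⟩
    exact ⟨L.leftOp i x, L.toHecke_leftOp i x⟩

/-- The Hecke algebra is free over `A` with basis `T_w`. -/
noncomputable def basisT : Module.Basis W (CoeffRing Γ) (Hecke L) :=
  .ofRepr (LinearEquiv.ofBijective L.toHecke L.toHecke_bijective).symm

theorem basisT_apply (w : W) : L.basisT w = L.T w := by
  rw [basisT, Module.Basis.apply_eq_iff]
  exact (LinearEquiv.symm_apply_eq _).mpr (L.toHecke_single w).symm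

end Basis

section Bar

variable {B W Γ : Type*} [Group W] {M : CoxeterMatrix B} {cs : CoxeterSystem M W}
  [AddCommGroup Γ] [LinearOrder Γ] (L : cs.WeightFunction Γ)

/-- The bar involution of the Hecke algebra, `∑ a_w T_w ↦ ∑ ā_w (T_{w⁻¹})⁻¹` (every `T_w` is
invertible, see `isUnit_T`). -/
noncomputable def bar (h : Hecke L) : Hecke L :=
  (L.basisT.repr h).sum fun w a => CoeffRing.conj a • Ring.inverse (L.T w⁻¹)

theorem repr_T (w : W) : L.basisT.repr (L.T w) = Finsupp.single w 1 := by
  rw [← basisT_apply, Module.Basis.repr_self]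

/-- Induction on the expansion in the `T`-basis. -/
theorem hecke_induction {P : Hecke L → Prop} (h0 : P 0) (hadd : ∀ x y, P x → P y → P (x + y))
    (hT : ∀ (a : CoeffRing Γ) (w : W), P (a • L.T w)) (h : Hecke L) : P h := by
  obtain ⟨x, rfl⟩ := L.toHecke_bijective.2 h
  induction x using Finsupp.induction_linear with
  | zero => rwa [map_zero]
  | add x y hx hy => rw [_root_.map_add]; exact hadd _ _ hx hy
  | single w a =>
    rw [← mul_one a, ← smul_eq_mul, ← Finsupp.smul_single, _root_.map_smul, toHecke_single]
    exact hT a w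

theorem bar_zero : L.bar 0 = 0 := by simp [bar]

theorem bar_add (x y : Hecke L) : L.bar (x + y) = L.bar x + L.bar y := by
  rw [bar, map_add, Finsupp.sum_add_index']
  · rfl
  · simp
  · intro w a b; rw [map_add, add_smul]

theorem bar_smul (a : CoeffRing Γ) (x : Hecke L) :
    L.bar (a • x) = CoeffRing.conj a • L.bar x := by
  rw [bar, map_smul, Finsupp.sum_smul_index, bar, Finsupp.smul_sum]
  · simp only [map_mul, mul_smul]
  · simp

theorem bar_neg (x : Hecke L) : L.bar (-x) = -L.bar x := by
  rw [eq_neg_iff_add_eq_zero, ← bar_add, neg_add_cancel, bar_zero]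

theorem bar_sub (x y : Hecke L) : L.bar (x - y) = L.bar x - L.bar y := by
  rw [sub_eq_add_neg, bar_add, bar_neg, sub_eq_add_neg]

theorem bar_T (w : W) : L.bar (L.T w) = Ring.inverse (L.T w⁻¹) := by
  rw [bar, repr_T, Finsupp.sum_single_index] <;> simp

theorem T_simple_mul_self (i : B) :
    L.T (cs.simple i) * L.T (cs.simple i) = 1 + (L.q i - L.qInv i) • L.T (cs.simple i) := by
  rw [T_simple_mul_of_gt, cs.simple_mul_simple_self, T_one]
  rw [cs.simple_mul_simple_self, cs.length_one, cs.length_simple]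
  exact one_pos

/-- The inverse `T_s - (q_s - q_s⁻¹)` of `T_s`. -/
noncomputable def TInv (i : B) : Hecke L := L.T (cs.simple i) - (L.q i - L.qInv i) • 1

theorem T_mul_TInv (i : B) : L.T (cs.simple i) * L.TInv i = 1 := by
  rw [TInv, mul_sub, T_simple_mul_self, mul_smul_comm, mul_one, add_sub_cancel_right]

theorem TInv_mul_T (i : B) : L.TInv i * L.T (cs.simple i) = 1 := by
  rw [TInv, sub_mul, T_simple_mul_self, smul_mul_assoc, one_mul, add_sub_cancel_right]

/-- Induction on the length, by left multiplication with simple reflections. -/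
theorem length_induction {P : W → Prop} (h1 : P 1)
    (hs : ∀ (i : B) (u : W), cs.length (cs.simple i * u) = cs.length u + 1 → P u →
      P (cs.simple i * u)) (w : W) : P w := by
  induction hn : cs.length w generalizing w with
  | zero => rwa [cs.length_eq_zero_iff.mp hn]
  | succ n ih =>
    obtain ⟨i, hi⟩ := cs.exists_leftDescent_of_ne_one
      (w := w) (by rintro rfl; simp at hn)
    have hl : cs.length (cs.simple i * w) = n := by
      have := cs.isLeftDescent_iff.mp hi
      omega
    have := hs i (cs.simple i * w) (by rw [cs.simple_mul_simple_cancel_left]; omega) (ih _ hl)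
    rwa [cs.simple_mul_simple_cancel_left] at this

theorem isUnit_T (w : W) : IsUnit (L.T w) := by
  induction w using length_induction (cs := cs) with
  | h1 => rw [T_one]; exact isUnit_one
  | hs i u hu ih =>
    rw [← T_simple_mul_of_lt _ (by omega)]
    exact IsUnit.mul ⟨⟨_, _, L.T_mul_TInv i, L.TInv_mul_T i⟩, rfl⟩ ih

theorem T_mul_simple_of_lt {w : W} {j : B} (h : cs.length w < cs.length (w * cs.simple j)) :
    L.T w * L.T (cs.simple j) = L.T (w * cs.simple j) := by
  induction w using length_induction (cs := cs) with
  | h1 => rw [T_one, one_mul, one_mul]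
  | hs i u hu ih =>
    have h1 : cs.length (cs.simple i * (u * cs.simple j)) ≤ 1 + cs.length (u * cs.simple j) := by
      simpa using cs.length_mul_le (cs.simple i) (u * cs.simple j)
    have h2 := cs.length_mul_simple u j
    rw [mul_assoc] at h ⊢
    rw [← T_simple_mul_of_lt _ (by omega), mul_assoc, ih (by omega),
      T_simple_mul_of_lt _ (by omega)]

theorem inverse_eq_of_mul_eq_one {a b : Hecke L} (ha : IsUnit a) (h : a * b = 1) :
    Ring.inverse a = b := by
  rw [← mul_one (Ring.inverse a), ← h, ← mul_assoc, Ring.inverse_mul_cancel _ ha, one_mul]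

theorem bar_T_simple_mul {i : B} {w : W} (h : cs.length w < cs.length (cs.simple i * w)) :
    L.bar (L.T (cs.simple i * w)) = L.TInv i * L.bar (L.T w) := by
  rw [bar_T, bar_T]
  apply L.inverse_eq_of_mul_eq_one (L.isUnit_T _)
  rw [mul_inv_rev, cs.inv_simple, ← T_mul_simple_of_lt, mul_assoc, ← mul_assoc _ (L.TInv i),
    T_mul_TInv, one_mul, Ring.mul_inverse_cancel _ (L.isUnit_T _)]
  rwa [← cs.length_inv, ← cs.length_inv (w⁻¹ * _), mul_inv_rev, inv_inv, cs.inv_simple]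

theorem bar_one : L.bar 1 = 1 := by
  rw [← T_one, bar_T, inv_one, T_one, Ring.inverse_one]

theorem conj_param (i : B) : CoeffRing.conj (L.q i - L.qInv i) = -(L.q i - L.qInv i) := by
  rw [map_sub, q, qInv, CoeffRing.conj_single, CoeffRing.conj_single, neg_neg, neg_sub]

theorem bar_simple_mul (i : B) (x : Hecke L) :
    L.bar (L.T (cs.simple i) * x) = L.TInv i * L.bar x := by
  induction x using L.hecke_induction with
  | h0 => rw [mul_zero, bar_zero, mul_zero]
  | hadd x y hx hy => rw [mul_add, bar_add, bar_add, hx, hy, mul_add]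
  | hT a w =>
    rw [mul_smul_comm, bar_smul, bar_smul, mul_smul_comm]
    congr 1
    rcases cs.length_simple_mul w i with h | h
    · rw [T_simple_mul_of_lt _ (by omega), bar_T_simple_mul _ (by omega)]
    · have h1 := L.bar_T_simple_mul (i := i) (w := cs.simple i * w)
        (by rw [cs.simple_mul_simple_cancel_left]; omega)
      rw [cs.simple_mul_simple_cancel_left] at h1
      rw [T_simple_mul_of_gt _ (by omega), bar_add, bar_smul, conj_param, h1, neg_smul,
        ← sub_eq_add_neg, ← smul_mul_assoc]
      set y := L.bar (L.T (cs.simple i * w))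
      calc y - (L.q i - L.qInv i) • L.TInv i * y
          = (L.T (cs.simple i) * L.TInv i) * y - (L.q i - L.qInv i) • L.TInv i * y := by
            rw [T_mul_TInv, one_mul]
        _ = L.TInv i * (L.TInv i * y) := by
            rw [← sub_mul, ← mul_assoc]
            congr 1
            conv_rhs => rw [TInv, sub_mul, smul_mul_assoc, one_mul]
            rfl

theorem bar_TInv_mul (i : B) (x : Hecke L) :
    L.bar (L.TInv i * x) = L.T (cs.simple i) * L.bar x := by
  conv_lhs => rw [TInv, sub_mul, smul_mul_assoc, one_mul]
  rw [bar_sub, bar_simple_mul, bar_smul, conj_param, TInv, sub_mul, smul_mul_assoc, one_mul,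
    neg_smul, sub_neg_eq_add, sub_add_cancel]

theorem bar_bar (x : Hecke L) : L.bar (L.bar x) = x := by
  induction x using L.hecke_induction with
  | h0 => rw [bar_zero, bar_zero]
  | hadd x y hx hy => rw [bar_add, bar_add, hx, hy]
  | hT a w =>
    rw [bar_smul, bar_smul, CoeffRing.conj_conj]
    congr 1
    induction w using length_induction (cs := cs) with
    | h1 => rw [T_one, bar_one, bar_one]
    | hs i u hu ih =>
      rw [bar_T_simple_mul _ (by omega), bar_TInv_mul, ih, T_simple_mul_of_lt _ (by omega)]

/-- The span of the `T_w` with `l(w) < n`. -/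
def low (n : ℕ) : Submodule (CoeffRing Γ) (Hecke L) where
  carrier := {h | ∀ w, n ≤ cs.length w → L.basisT.repr h w = 0}
  zero_mem' := by simp
  add_mem' := by
    intro x y hx hy w hw
    rw [map_add, Finsupp.add_apply, hx w hw, hy w hw, add_zero]
  smul_mem' := by
    intro a x hx w hw
    rw [map_smul, Finsupp.smul_apply, hx w hw, smul_zero]

theorem low_mono {m n : ℕ} (h : m ≤ n) : L.low m ≤ L.low n :=
  fun _ hx w hw => hx w (h.trans hw)

theorem T_mem_low {w : W} {n : ℕ} (h : cs.length w < n) : L.T w ∈ L.low n := by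
  classical
  intro v hv
  rw [repr_T, Finsupp.single_apply, if_neg]
  rintro rfl
  omega

theorem low_le {n : ℕ} {N : Submodule (CoeffRing Γ) (Hecke L)}
    (h : ∀ w, cs.length w < n → L.T w ∈ N) : L.low n ≤ N := by
  intro x hx
  rw [← L.basisT.linearCombination_repr x, Finsupp.linearCombination_apply]
  refine N.sum_mem fun w hw => N.smul_mem _ ?_
  rw [basisT_apply]
  refine h w ?_
  by_contra hl
  exact Finsupp.mem_support_iff.mp hw (hx w (by omega))

theorem exists_mem_low (x : Hecke L) : ∃ n, x ∈ L.low n := by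
  induction x using L.hecke_induction with
  | h0 => exact ⟨0, Submodule.zero_mem _⟩
  | hadd x y hx hy =>
    obtain ⟨m, hm⟩ := hx
    obtain ⟨n, hn⟩ := hy
    exact ⟨max m n, Submodule.add_mem _ (L.low_mono (le_max_left _ _) hm)
      (L.low_mono (le_max_right _ _) hn)⟩
  | hT a w => exact ⟨cs.length w + 1, Submodule.smul_mem _ _ (L.T_mem_low (by omega))⟩

theorem eq_zero_of_mem_low_zero {x : Hecke L} (h : x ∈ L.low 0) : x = 0 := by
  apply L.basisT.repr.injective
  rw [map_zero]
  ext1 w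
  exact h w (Nat.zero_le _)

theorem mem_low_of_succ {n : ℕ} {x : Hecke L} (h : x ∈ L.low (n + 1))
    (h' : ∀ w, cs.length w = n → L.basisT.repr x w = 0) : x ∈ L.low n := by
  intro w hw
  rcases hw.eq_or_lt with h1 | h1
  · exact h' w h1.symm
  · exact h w h1

/-- Descent along the length filtration. -/
theorem eq_zero_of_forall {x : Hecke L}
    (h : ∀ n, x ∈ L.low (n + 1) → ∀ w, cs.length w = n → L.basisT.repr x w = 0) : x = 0 := by
  obtain ⟨n, hn⟩ := L.exists_mem_low x
  induction n with
  | zero => exact L.eq_zero_of_mem_low_zero hn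
  | succ n ih => exact ih (L.mem_low_of_succ hn (h n hn))

theorem TInv_mul_mem_low (i : B) {n : ℕ} {x : Hecke L} (hx : x ∈ L.low n) :
    L.TInv i * x ∈ L.low (n + 1) := by
  have : L.low n ≤ (L.low (n + 1)).comap (LinearMap.mulLeft (CoeffRing Γ) (L.TInv i)) := by
    refine L.low_le fun w hw => ?_
    rw [Submodule.mem_comap, LinearMap.mulLeft_apply, TInv, sub_mul, smul_mul_assoc, one_mul]
    refine Submodule.sub_mem _ ?_ (Submodule.smul_mem _ _ (L.T_mem_low (by omega)))
    rcases cs.length_simple_mul w i with h | h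
    · rw [T_simple_mul_of_lt _ (by omega)]
      exact L.T_mem_low (by omega)
    · rw [T_simple_mul_of_gt _ (by omega)]
      exact Submodule.add_mem _ (L.T_mem_low (by omega))
        (Submodule.smul_mem _ _ (L.T_mem_low (by omega)))
  exact this hx

theorem bar_T_sub_mem_low (w : W) : L.bar (L.T w) - L.T w ∈ L.low (cs.length w) := by
  induction w using length_induction (cs := cs) with
  | h1 => rw [T_one, bar_one, sub_self]; exact Submodule.zero_mem _
  | hs i u hu ih =>
    have e : L.bar (L.T (cs.simple i * u)) - L.T (cs.simple i * u) =
        L.TInv i * (L.bar (L.T u) - L.T u) - (L.q i - L.qInv i) • L.T u := by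
      rw [bar_T_simple_mul _ (by omega), mul_sub, ← T_simple_mul_of_lt _ (by omega)]
      nth_rewrite 3 [TInv]
      rw [sub_mul, smul_mul_assoc, one_mul]
      abel
    rw [e, hu]
    exact Submodule.sub_mem _ (L.TInv_mul_mem_low i ih)
      (Submodule.smul_mem _ _ (L.T_mem_low (by omega)))

/-- Leading coefficients of a combination of elements `X_w ∈ T_w + ⟨T_y | l(y) < l(w)⟩`. -/
theorem repr_sum_eq {X : W → Hecke L} (hX : ∀ w, X w - L.T w ∈ L.low (cs.length w))
    (f : CoeffRing Γ →+* CoeffRing Γ) {n : ℕ} {x : Hecke L} (hx : x ∈ L.low (n + 1)) {v : W}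
    (hv : cs.length v = n) :
    L.basisT.repr ((L.basisT.repr x).sum fun w a => f a • X w) v = f (L.basisT.repr x v) := by
  classical
  have h1 : ∀ w ∈ (L.basisT.repr x).support,
      L.basisT.repr (f (L.basisT.repr x w) • X w) v =
        if w = v then f (L.basisT.repr x w) else 0 := by
    intro w hw
    have hl : cs.length w ≤ cs.length v := by
      by_contra hl
      exact Finsupp.mem_support_iff.mp hw (hx w (by omega))
    have h2 := hX w v hl
    rw [map_sub, Finsupp.sub_apply, repr_T, sub_eq_zero] at h2
    rw [map_smul, Finsupp.smul_apply, h2, Finsupp.single_apply, smul_eq_mul, mul_ite, mul_one,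
      mul_zero]
  rw [Finsupp.sum, map_sum, Finsupp.finsetSum_apply, Finset.sum_congr rfl h1,
    Finset.sum_ite_eq']
  split_ifs with h
  · rfl
  · rw [Finsupp.notMem_support_iff.mp h, map_zero]

theorem repr_bar {n : ℕ} {x : Hecke L} (hx : x ∈ L.low (n + 1)) {v : W}
    (hv : cs.length v = n) :
    L.basisT.repr (L.bar x) v = CoeffRing.conj (L.basisT.repr x v) := by
  rw [← L.repr_sum_eq (X := fun w => L.bar (L.T w)) L.bar_T_sub_mem_low CoeffRing.conj hx hv]
  simp only [bar_T]
  rfl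

theorem bar_mem_low {n : ℕ} {x : Hecke L} (hx : x ∈ L.low n) : L.bar x ∈ L.low n := by
  rw [bar]
  refine Submodule.sum_mem _ fun w hw => Submodule.smul_mem _ _ ?_
  have hl : cs.length w < n := by
    by_contra hl
    exact Finsupp.mem_support_iff.mp hw (hx w (by omega))
  rw [← bar_T, ← sub_add_cancel (L.bar (L.T w)) (L.T w)]
  exact Submodule.add_mem _ (L.low_mono hl.le (L.bar_T_sub_mem_low w)) (L.T_mem_low hl)

/-- `ℋ_{<0} = ∑_w A_{<0} T_w`. -/
def heckeNeg : AddSubgroup (Hecke L) where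
  carrier := {h | ∀ w, L.basisT.repr h w ∈ CoeffRing.neg Γ}
  zero_mem' := by intro w; rw [map_zero]; exact AddSubgroup.zero_mem _
  add_mem' := by
    intro x y hx hy w
    rw [map_add]
    exact AddSubgroup.add_mem _ (hx w) (hy w)
  neg_mem' := by
    intro x hx w
    rw [map_neg]
    exact AddSubgroup.neg_mem _ (hx w)

end Bar
section KazhdanLusztig

variable {B W Γ : Type*} [Group W] {M : CoxeterMatrix B} {cs : CoxeterSystem M W}
  [AddCommGroup Γ] [LinearOrder Γ] [IsOrderedAddMonoid Γ] (L : cs.WeightFunction Γ)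

theorem eq_zero_of_bar_eq {x : Hecke L} (hx : x ∈ L.heckeNeg) (h : L.bar x = x) : x = 0 := by
  refine L.eq_zero_of_forall fun n hn w hw => ?_
  refine CoeffRing.eq_zero_of_conj_eq (hx w) ?_
  rw [← L.repr_bar hn hw, h]

theorem exists_sub_bar {n : ℕ} {x : Hecke L} (hx : x ∈ L.low n) (h : L.bar x = -x) :
    ∃ g ∈ L.low n, g ∈ L.heckeNeg ∧ x = g - L.bar g := by
  classical
  induction n generalizing x with
  | zero =>
    refine ⟨0, Submodule.zero_mem _, AddSubgroup.zero_mem _, ?_⟩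
    rw [L.eq_zero_of_mem_low_zero hx, bar_zero, sub_zero]
  | succ n ih =>
    have hex : ∀ w : W, ∃ b ∈ CoeffRing.neg Γ,
        (cs.length w = n → L.basisT.repr x w = b - CoeffRing.conj b) ∧
        (L.basisT.repr x w = 0 ∨ cs.length w ≠ n → b = 0) := by
      intro w
      by_cases hw : L.basisT.repr x w = 0 ∨ cs.length w ≠ n
      · refine ⟨0, AddSubgroup.zero_mem _, fun hl => ?_, fun _ => rfl⟩
        rw [map_zero, sub_zero]
        exact hw.resolve_right (by simpa using hl)
      · have hl : cs.length w = n := by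
          by_contra hl; exact hw (Or.inr hl)
        obtain ⟨b, hb, hb'⟩ := CoeffRing.exists_sub_conj (a := L.basisT.repr x w)
          (by rw [← L.repr_bar hx hl, h, map_neg, Finsupp.neg_apply])
        exact ⟨b, hb, fun _ => hb', fun h' => absurd h' hw⟩
    choose b hb hb1 hb2 using hex
    let c : W →₀ CoeffRing Γ := Finsupp.onFinset (L.basisT.repr x).support b (by
      intro w hw
      rw [Finsupp.mem_support_iff]
      exact fun h0 => hw (hb2 w (Or.inl h0)))
    have hc : ∀ w, L.basisT.repr (L.basisT.repr.symm c) w = b w := by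
      intro w
      rw [LinearEquiv.apply_symm_apply]
      rfl
    set g := L.basisT.repr.symm c with hg
    have hglow : g ∈ L.low (n + 1) := by
      intro w hw
      rw [hc]
      exact hb2 w (Or.inr (by omega))
    have hgneg : g ∈ L.heckeNeg := by
      intro w
      rw [hc]
      exact hb w
    have h1 : x - (g - L.bar g) ∈ L.low n := by
      refine L.mem_low_of_succ (Submodule.sub_mem _ hx (Submodule.sub_mem _ hglow
        (L.bar_mem_low hglow))) fun w hw => ?_
      rw [map_sub, map_sub, Finsupp.sub_apply, Finsupp.sub_apply, L.repr_bar hglow hw, hc,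
        hb1 w hw, sub_self]
    obtain ⟨g', hg'low, hg'neg, hg'⟩ := ih h1 (by
      rw [bar_sub, bar_sub, bar_bar, h]; abel)
    refine ⟨g + g', Submodule.add_mem _ hglow (L.low_mono n.le_succ hg'low),
      AddSubgroup.add_mem _ hgneg hg'neg, ?_⟩
    rw [bar_add, add_sub_add_comm, ← hg']
    abel

theorem exists_C (w : W) : ∃ c : Hecke L, (L.bar c = c ∧ c - L.T w ∈ L.heckeNeg) ∧
    c - L.T w ∈ L.low (cs.length w) := by
  obtain ⟨g, hg, hg', h⟩ := L.exists_sub_bar (L.bar_T_sub_mem_low w)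
    (by rw [bar_sub, bar_bar, neg_sub])
  refine ⟨L.T w + g, ⟨?_, ?_⟩, ?_⟩
  · rw [bar_add, sub_eq_sub_iff_add_eq_add.mp h]
    abel
  · rwa [add_sub_cancel_left]
  · rwa [add_sub_cancel_left]

/-- Existence and uniqueness of the Kazhdan–Lusztig basis elements. -/
theorem existsUnique_C (w : W) : ∃! c : Hecke L, L.bar c = c ∧ c - L.T w ∈ L.heckeNeg := by
  obtain ⟨c, hc, -⟩ := L.exists_C w
  refine ⟨c, hc, fun d hd => sub_eq_zero.mp (L.eq_zero_of_bar_eq ?_ ?_)⟩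
  · rw [← sub_sub_sub_cancel_right d c (L.T w)]
    exact AddSubgroup.sub_mem _ hd.2 hc.2
  · rw [bar_sub, hd.1, hc.1]

/-- The Kazhdan–Lusztig basis element `C_w`, the unique bar-invariant element congruent to `T_w`
modulo `ℋ_{<0}`. -/
noncomputable def C (w : W) : Hecke L := (L.existsUnique_C w).choose

theorem bar_C (w : W) : L.bar (L.C w) = L.C w := (L.existsUnique_C w).choose_spec.1.1

theorem C_sub_T_mem (w : W) : L.C w - L.T w ∈ L.heckeNeg :=
  (L.existsUnique_C w).choose_spec.1.2

theorem eq_C {w : W} {c : Hecke L} (h : L.bar c = c) (h' : c - L.T w ∈ L.heckeNeg) : c = L.C w :=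
  (L.existsUnique_C w).choose_spec.2 c ⟨h, h'⟩

theorem C_sub_T_mem_low (w : W) : L.C w - L.T w ∈ L.low (cs.length w) := by
  obtain ⟨c, hc, hc'⟩ := L.exists_C w
  rwa [← L.eq_C hc.1 hc.2]

theorem C_one : L.C 1 = 1 :=
  (L.eq_C L.bar_one (by rw [T_one, sub_self]; exact AddSubgroup.zero_mem _)).symm

theorem C_simple (i : B) : L.C (cs.simple i) = L.T (cs.simple i) + L.qInv i • 1 := by
  classical
  refine (L.eq_C ?_ ?_).symm
  · have := L.bar_simple_mul i 1
    rw [mul_one, bar_one, mul_one] at this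
    rw [bar_add, bar_smul, bar_one, this, TInv, qInv, CoeffRing.conj_single, neg_neg, sub_smul]
    change _ - (L.q i • 1 - L.qInv i • 1) + L.q i • 1 = _ + L.qInv i • 1
    abel
  · rw [add_sub_cancel_left, ← T_one]
    intro w γ hγ
    rw [map_smul, repr_T, Finsupp.smul_apply, Finsupp.single_apply] at hγ
    have h1 : (L.qInv i).coeff γ ≠ 0 := by
      intro h0
      apply hγ
      split_ifs <;> simp [h0]
    rw [qInv] at h1
    have h2 : -L.toFun (cs.simple i) = γ := by
      by_contra h
      exact h1 (by simp [h])
    rw [← h2]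
    exact neg_lt_zero.mpr (L.pos i)

/-- The linear map `T_w ↦ C_w`. -/
noncomputable def mapC : Hecke L →ₗ[CoeffRing Γ] Hecke L :=
  (Finsupp.linearCombination (CoeffRing Γ) L.C).comp L.basisT.repr.toLinearMap

theorem mapC_T (w : W) : L.mapC (L.T w) = L.C w := by
  rw [mapC, LinearMap.comp_apply, LinearEquiv.coe_coe, repr_T,
    Finsupp.linearCombination_single, one_smul]

theorem mapC_bijective : Function.Bijective L.mapC := by
  constructor
  · rw [← LinearMap.ker_eq_bot, LinearMap.ker_eq_bot']
    intro x hx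
    refine L.eq_zero_of_forall fun n hn w hw => ?_
    have h := L.repr_sum_eq L.C_sub_T_mem_low (RingHom.id _) hn hw
    simp only [RingHom.id_apply] at h
    rw [← h]
    have h2 : ((L.basisT.repr x).sum fun w a => a • L.C w) = 0 := hx
    rw [h2, map_zero, Finsupp.zero_apply]
  · rw [← LinearMap.range_eq_top]
    have hT : ∀ n, ∀ w, cs.length w < n → L.T w ∈ LinearMap.range L.mapC := by
      intro n
      induction n with
      | zero => intro w hw; omega
      | succ n ih =>
        intro w hw
        have h1 := L.low_le ih (L.low_mono (by omega) (L.C_sub_T_mem_low w))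
        rw [← sub_sub_cancel (L.C w) (L.T w)]
        exact Submodule.sub_mem _ ⟨L.T w, L.mapC_T w⟩ h1
    rw [eq_top_iff]
    intro x _
    obtain ⟨n, hn⟩ := L.exists_mem_low x
    exact L.low_le (hT n) hn

/-- The Kazhdan–Lusztig basis of the Hecke algebra. -/
noncomputable def basisC : Module.Basis W (CoeffRing Γ) (Hecke L) :=
  L.basisT.map (LinearEquiv.ofBijective L.mapC L.mapC_bijective)

theorem basisC_apply (w : W) : L.basisC w = L.C w := by
  rw [basisC, Module.Basis.map_apply, LinearEquiv.ofBijective_apply, basisT_apply, mapC_T]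

/-- The structure constants, `C_x C_y = ∑_z h_{x,y,z} C_z`. -/
noncomputable def h (x y z : W) : CoeffRing Γ := L.basisC.repr (L.C x * L.C y) z

/-- `x ←_L y`: there is `s ∈ S` such that `C_x` occurs in `C_s C_y`. -/
def LeftStep (x y : W) : Prop := ∃ i : B, L.h (cs.simple i) y x ≠ 0

/-- `x ←_R y`: there is `s ∈ S` such that `C_x` occurs in `C_y C_s`. -/
def RightStep (x y : W) : Prop := ∃ i : B, L.h y (cs.simple i) x ≠ 0

/-- The Kazhdan–Lusztig left pre-order `x ≤_L y`. -/
def LeLeft : W → W → Prop := Relation.ReflTransGen L.LeftStep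

/-- The Kazhdan–Lusztig right pre-order `x ≤_R y`. -/
def LeRight : W → W → Prop := Relation.ReflTransGen L.RightStep

/-- The equivalence relation `x ~_L y`. -/
def SimLeft (x y : W) : Prop := L.LeLeft x y ∧ L.LeLeft y x

/-- The equivalence relation `x ~_R y`. -/
def SimRight (x y : W) : Prop := L.LeRight x y ∧ L.LeRight y x

/-- The left cells are the equivalence classes of `~_L`. -/
def IsLeftCell (D : Set W) : Prop := ∃ x, D = {y | L.SimLeft y x}

/-- For `I` closed under going down in `≤_L`, the span `⟨C_w | w ∈ I⟩_A`, as a left ideal. -/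
noncomputable def spanC (I : Set W) (hI : ∀ x y, L.LeLeft x y → y ∈ I → x ∈ I) :
    Submodule (Hecke L) (Hecke L) :=
  { Submodule.span (CoeffRing Γ) (L.C '' I) with
    smul_mem' := by
      let N : Submodule (CoeffRing Γ) (Hecke L) := Submodule.span (CoeffRing Γ) (L.C '' I)
      let P : Submodule (CoeffRing Γ) (Hecke L) :=
        { carrier := {a | ∀ x ∈ N, a * x ∈ N}
          zero_mem' := fun x _ => by rw [zero_mul]; exact N.zero_mem
          add_mem' := fun ha hb x hx => by
            rw [add_mul]; exact N.add_mem (ha x hx) (hb x hx)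
          smul_mem' := fun c a ha x hx => by
            rw [smul_mul_assoc]; exact N.smul_mem c (ha x hx) }
      have hC : ∀ i : B, N ≤ N.comap (LinearMap.mulLeft (CoeffRing Γ) (L.C (cs.simple i))) := by
        intro i
        refine Submodule.span_le.mpr ?_
        rintro _ ⟨y, hy, rfl⟩
        change L.C (cs.simple i) * L.C y ∈ N
        rw [← L.basisC.linearCombination_repr (L.C (cs.simple i) * L.C y),
          Finsupp.linearCombination_apply]
        refine N.sum_mem fun z hz => N.smul_mem _ (Submodule.subset_span ⟨z, ?_, ?_⟩)
        · exact hI z y (Relation.ReflTransGen.single ⟨i, Finsupp.mem_support_iff.mp hz⟩) hy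
        · rw [basisC_apply]
      have hP : P = ⊤ := by
        refine L.hecke_eq_top P (fun x hx => by rwa [one_mul]) ?_
        intro i a ha x hx
        have h1 : L.T (cs.simple i) * a * x =
            L.C (cs.simple i) * (a * x) - L.qInv i • (a * x) := by
          rw [C_simple, add_mul, smul_mul_assoc, one_mul, add_sub_cancel_right, mul_assoc]
        rw [h1]
        exact N.sub_mem (hC i (ha x hx)) (N.smul_mem _ (ha x hx))
      intro c x hx
      have hc : c ∈ P := by rw [hP]; trivial
      exact hc x hx }

/-- The left ideal `⟨C_w | w ≤_L z for some z ∈ D⟩_A`. -/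
noncomputable def cellIdeal (D : Set W) : Submodule (Hecke L) (Hecke L) :=
  L.spanC {w | ∃ z ∈ D, L.LeLeft w z} fun _ _ hxy ⟨z, hz, hyz⟩ => ⟨z, hz, hxy.trans hyz⟩

variable {L}

/-- The left ideal `⟨C_w | w ∉ D, w ≤_L z for some z ∈ D⟩_A` of a left cell `D`. -/
noncomputable def IsLeftCell.lowerIdeal {D : Set W} (hD : L.IsLeftCell D) :
    Submodule (Hecke L) (Hecke L) :=
  L.spanC {w | w ∉ D ∧ ∃ z ∈ D, L.LeLeft w z} <| by
    rintro x y hxy ⟨hy, z, hz, hyz⟩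
    refine ⟨fun hx => hy ?_, z, hz, hxy.trans hyz⟩
    obtain ⟨d, rfl⟩ := hD
    exact ⟨hyz.trans hz.1, hx.2.trans hxy⟩

/-- The left cell module `[D]_A`. -/
abbrev IsLeftCell.CellModule {D : Set W} (hD : L.IsLeftCell D) : Type _ :=
  L.cellIdeal D ⧸ hD.lowerIdeal.submoduleOf (L.cellIdeal D)

end KazhdanLusztig

section Characters

variable {B W Γ : Type*} [Group W] {M : CoxeterMatrix B} {cs : CoxeterSystem M W}
  [AddCommGroup Γ] [LinearOrder Γ] [IsOrderedAddMonoid Γ] (L : cs.WeightFunction Γ)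

open scoped TensorProduct

noncomputable instance : Algebra (CoeffRing Γ) (AddMonoidAlgebra ℝ Γ) :=
  (AddMonoidAlgebra.mapRingHom Γ (Int.castRingHom ℝ)).toAlgebra

/-- The field of fractions `K` of `ℝ[Γ] ⊇ A`. -/
abbrev FractionField (Γ : Type*) [AddCommGroup Γ] [LinearOrder Γ] [IsOrderedAddMonoid Γ] : Type _ :=
  FractionRing (AddMonoidAlgebra ℝ Γ)

/-- The scalar extension `ℋ_K = K ⊗_A ℋ`. -/
abbrev HeckeK : Type _ := FractionField Γ ⊗[CoeffRing Γ] Hecke L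

variable {L} {D : Set W} (hD : L.IsLeftCell D)

/-- The left cell module `[D]_K = K ⊗_A [D]_A`, as a representation of `ℋ_K`: an element `k ⊗ h`
acts as `k' ⊗ c ↦ kk' ⊗ h c`. -/
noncomputable def IsLeftCell.rep : HeckeK L →ₐ[FractionField Γ]
    Module.End (FractionField Γ) (FractionField Γ ⊗[CoeffRing Γ] hD.CellModule) :=
  Algebra.TensorProduct.lift (Algebra.ofId _ _)
    ((Module.End.baseChangeHom (CoeffRing Γ) (FractionField Γ) hD.CellModule).comp
      (Algebra.lsmul (CoeffRing Γ) (CoeffRing Γ) hD.CellModule))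
    fun k _ => Algebra.commute_algebraMap_left k _

/-- The character `χ_D` afforded by the left cell module `[D]_K`. -/
noncomputable def IsLeftCell.character : HeckeK L →ₗ[FractionField Γ] FractionField Γ :=
  (LinearMap.trace (FractionField Γ) (FractionField Γ ⊗[CoeffRing Γ] hD.CellModule)).comp
    hD.rep.toLinearMap

variable (L)

/-- `Irr(ℋ_K)`: the characters of the irreducible finite-dimensional representations of `ℋ_K`
over `K`. -/
def Irr : Set (HeckeK L →ₗ[FractionField Γ] FractionField Γ) :=
  {χ | ∃ (d : ℕ) (ρ : HeckeK L →ₐ[FractionField Γ]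
      Module.End (FractionField Γ) (Fin d → FractionField Γ)),
    0 < d ∧
    (∀ U : Submodule (FractionField Γ) (Fin d → FractionField Γ),
      (∀ a, ∀ v ∈ U, ρ a v ∈ U) → U = ⊥ ∨ U = ⊤) ∧
    ∀ a, χ a = LinearMap.trace (FractionField Γ) (Fin d → FractionField Γ) (ρ a)}

end Characters

end CoxeterSystem.WeightFunction

/-! The Hecke algebra carries the trace form `τ(∑ a_w T_w) = a_1`, for which `T_{w⁻¹}` is the basis
dual to `T_w`. Since `W` is finite, the Kazhdan–Lusztig basis also has a dual basis `D_z`,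
characterised by: `τ(a D_z)` is the coefficient of `C_z` in `a`. Hence `τ(a C_x D_z)` is the
coefficient of `C_z` in `a C_x`, and nondegeneracy turns the equalities `h_{w,x,z} = h_{w,x₁,z₁}`
for all `w` into one identity in the algebra, `C_x D_z = C_{x₁} D_{z₁}` (`C_mul_dualC_eq`).

Suppose now that `C_x` occurs in `C_x D_z C_z` for some `z` in the left cell of `x`. Replacing the
first two factors shows that `C_x` occurs in `C_{x₁} (D_{z₁} C_z)`, a right multiple of `C_{x₁}`, so
`x ≤_R x₁`. The inverse bijection gives the opposite inequality.

The existence of `z` (`exists_repr_C_mul_dualC_mul_C_ne_zero`) comes from the Casimir-type element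
`∑_z D_z C_z = ∑_w T_{w⁻¹} T_w`. Under `e^γ ↦ 1` the right side becomes `|W|` times the identity, so
the coefficient of `C_x` in `C_x ∑_z D_z C_z` specialises to `|W| ≠ 0` and some summand must
contribute. Such a `z` automatically lies in the left cell of `x`: `C_x D_z ≠ 0` forces `z ≤_L x`,
and the occurrence of `C_x` in a left multiple of `C_z` forces `x ≤_L z`. -/

namespace CoxeterSystem.WeightFunction

/-! ### The trace form and its dual bases. -/

section DualBasis

variable {B W Γ : Type*} [Group W] {M : CoxeterMatrix B} {cs : CoxeterSystem M W}
  [AddCommGroup Γ] [LinearOrder Γ] (L : cs.WeightFunction Γ)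

/-- The canonical trace form `∑ a_w T_w ↦ a_1`. -/
noncomputable def traceForm : Hecke L →ₗ[CoeffRing Γ] CoeffRing Γ := L.basisT.coord 1

open Classical in
theorem traceForm_T (w : W) : L.traceForm (L.T w) = if w = 1 then 1 else 0 := by
  rw [traceForm, Module.Basis.coord_apply, repr_T, Finsupp.single_apply]

theorem T_inv_mul_simple {i : B} {u : W} (h : cs.length u < cs.length (cs.simple i * u)) :
    L.T (u⁻¹ * cs.simple i) = L.T u⁻¹ * L.T (cs.simple i) := by
  refine (L.T_mul_simple_of_lt ?_).symm
  rwa [← cs.length_inv, ← cs.length_inv (u⁻¹ * _), mul_inv_rev, inv_inv, cs.inv_simple]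

-- Writing `v = su` with `l(su) > l(u)`, the factor `T_s` split off from `T_{v⁻¹}` can be moved onto
-- `T_y`. This reduces the claim to `u` and `sy`, apart from a possible extra term in `T_y`.
open Classical in
theorem traceForm_T_inv_mul_T (v y : W) :
    L.traceForm (L.T v⁻¹ * L.T y) = if v = y then 1 else 0 := by
  induction v using length_induction (cs := cs) generalizing y with
  | h1 =>
    rw [inv_one, T_one, one_mul, traceForm_T]
    exact if_congr eq_comm rfl rfl
  | hs i u hu ih =>
    have hiff : u = cs.simple i * y ↔ cs.simple i * u = y := by
      constructor
      · rintro rfl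
        exact cs.simple_mul_simple_cancel_left i
      · rintro rfl
        exact (cs.simple_mul_simple_cancel_left i).symm
    rw [mul_inv_rev, cs.inv_simple, L.T_inv_mul_simple (by omega), mul_assoc]
    rcases cs.length_simple_mul y i with h | h
    · rw [T_simple_mul_of_lt _ (by omega), ih, if_congr hiff rfl rfl]
    -- The extra term `(q_s - q_s⁻¹) T_y` contributes nothing: `s` is a left descent of `y` but not
    -- of `u`.
    · have hne : u ≠ y := by
        rintro rfl
        omega
      rw [T_simple_mul_of_gt _ (by omega), mul_add, mul_smul_comm, map_add, map_smul, ih, ih,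
        if_neg hne, smul_zero, add_zero, if_congr hiff rfl rfl]

/-- Every coordinate in the `T`-basis is thus read off by the trace form, which is what makes the
form nondegenerate. -/
theorem traceForm_T_inv_mul (w : W) (x : Hecke L) :
    L.traceForm (L.T w⁻¹ * x) = L.basisT.repr x w := by
  classical
  induction x using L.hecke_induction with
  | h0 => simp
  | hadd x y hx hy => rw [mul_add, map_add, map_add, Finsupp.add_apply, hx, hy]
  | hT a v =>
    rw [mul_smul_comm, map_smul, map_smul, Finsupp.smul_apply, traceForm_T_inv_mul_T, repr_T,
      Finsupp.single_apply]
    congr 1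
    exact if_congr eq_comm rfl rfl

/-- Nondegeneracy of the trace form. -/
theorem eq_of_traceForm_mul_eq {x y : Hecke L}
    (h : ∀ a, L.traceForm (a * x) = L.traceForm (a * y)) : x = y := by
  apply L.basisT.repr.injective
  ext1 w
  rw [← traceForm_T_inv_mul, ← traceForm_T_inv_mul, h]

/-- The element representing a linear functional `f` with respect to the trace form. -/
noncomputable def dualElement [Fintype W] (f : Hecke L →ₗ[CoeffRing Γ] CoeffRing Γ) : Hecke L :=
  ∑ w, f (L.T w) • L.T w⁻¹

/-- Every linear functional is represented by an element. Finiteness of `W` makes the sum defining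
that element meaningful, and `T_{w⁻¹}` being dual to `T_w` makes it evaluate correctly. -/
theorem traceForm_mul_dualElement [Fintype W] (f : Hecke L →ₗ[CoeffRing Γ] CoeffRing Γ)
    (x : Hecke L) : L.traceForm (x * L.dualElement f) = f x := by
  classical
  induction x using L.hecke_induction with
  | h0 => simp
  | hadd x y hx hy => rw [add_mul, map_add, map_add, hx, hy]
  | hT a v =>
    rw [smul_mul_assoc, map_smul, map_smul, dualElement, Finset.mul_sum, map_sum]
    congr 1
    have h1 : ∀ w, L.traceForm (L.T v * f (L.T w) • L.T w⁻¹) =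
        if w = v then f (L.T w) else 0 := by
      intro w
      -- Passing to inverses gives the duality with the inverse on the right-hand factor, `T_v
      -- T_{w⁻¹}`.
      have h2 := L.traceForm_T_inv_mul_T v⁻¹ w⁻¹
      rw [inv_inv] at h2
      rw [mul_smul_comm, map_smul, h2, smul_eq_mul, mul_ite, mul_one, mul_zero]
      exact if_congr (by rw [inv_inj, eq_comm]) rfl rfl
    rw [Finset.sum_congr rfl fun w _ => h1 w, Finset.sum_ite_eq' Finset.univ v,
      if_pos (Finset.mem_univ v)]

end DualBasis

/-! ### Specialisation at `e^γ = 1`. -/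

section Specialization

/-- The augmentation `ℤ[Γ] → ℤ`, `e^γ ↦ 1`. -/
noncomputable def augmentation (Γ : Type*) [AddCommGroup Γ] : CoeffRing Γ →+* ℤ :=
  (AddMonoidAlgebra.lift ℤ ℤ Γ 1 : CoeffRing Γ →ₐ[ℤ] ℤ).toRingHom

theorem augmentation_single {Γ : Type*} [AddCommGroup Γ] (γ : Γ) : augmentation Γ (AddMonoidAlgebra.single γ 1) = 1 := by
  simp [augmentation]

variable {B W Γ : Type*} [Group W] {M : CoxeterMatrix B} {cs : CoxeterSystem M W}
  [AddCommGroup Γ] [LinearOrder Γ] (L : cs.WeightFunction Γ)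

/-- At `e^γ = 1` the element `T_{w⁻¹} T_w` becomes the identity. -/
theorem augmentation_mul_T_inv_mul_T (f : Hecke L →ₗ[CoeffRing Γ] CoeffRing Γ) (a : Hecke L)
    (w : W) : augmentation Γ (f (a * (L.T w⁻¹ * L.T w))) = augmentation Γ (f a) := by
  induction w using length_induction (cs := cs) with
  | h1 => rw [inv_one, T_one, mul_one, mul_one]
  | hs i u hu ih =>
    -- The product is `T_{u⁻¹} T_s² T_u`. The quadratic relation leaves an error term with factor
    -- `q_s - q_s⁻¹`, which the augmentation kills.
    have h1 : L.T (cs.simple i * u)⁻¹ * L.T (cs.simple i * u) =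
        L.T u⁻¹ * L.T u +
          (L.q i - L.qInv i) • (L.T u⁻¹ * (L.T (cs.simple i) * L.T u)) := by
      rw [mul_inv_rev, cs.inv_simple, L.T_inv_mul_simple (by omega), ← T_simple_mul_of_lt _ (by omega), mul_assoc,
        ← mul_assoc (L.T (cs.simple i)) (L.T (cs.simple i)), T_simple_mul_self, add_mul, one_mul,
        smul_mul_assoc, mul_add, mul_smul_comm]
    rw [h1, mul_add, mul_smul_comm, map_add, map_smul, smul_eq_mul, map_add,
      map_mul (augmentation Γ), map_sub, q, qInv, augmentation_single, augmentation_single, sub_self, zero_mul, add_zero, ih]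

end Specialization

/-! ### One-sided pre-orders under multiplication by arbitrary elements. -/

section Cells

variable {B W Γ : Type*} [Group W] {M : CoxeterMatrix B} {cs : CoxeterSystem M W}
  [AddCommGroup Γ] [LinearOrder Γ] [IsOrderedAddMonoid Γ] (L : cs.WeightFunction Γ)

theorem mem_of_mem_span_C {I : Set W} {x : Hecke L} {v : W}
    (hx : x ∈ Submodule.span (CoeffRing Γ) (L.C '' I)) (hv : L.basisC.repr x v ≠ 0) : v ∈ I := by
  have hC : L.C = L.basisC := funext fun w => (L.basisC_apply w).symm
  rw [hC, Module.Basis.mem_span_image] at hx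
  exact hx (Finsupp.mem_support_iff.mpr hv)

/-- The pre-order is generated by multiplication by `C_s` alone, but the span of the `C_w` with `w
≤_L y` is a left ideal, so any multiplier `a` is allowed. -/
theorem leLeft_of_repr_mul_C_ne_zero {a : Hecke L} {y v : W}
    (hv : L.basisC.repr (a * L.C y) v ≠ 0) : L.LeLeft v y := by
  let N := L.spanC {w | L.LeLeft w y} fun _ _ h1 h2 => h1.trans h2
  have h1 : L.C y ∈ N := Submodule.subset_span ⟨y, Relation.ReflTransGen.refl, rfl⟩
  exact L.mem_of_mem_span_C (I := {w | L.LeLeft w y}) (N.smul_mem a h1) hv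

/-- The span `N` of the `C_w` with `w ≤_R y` is a right ideal: the elements `a` with `N a ⊆ N` form
a submodule `P` that contains `1` and is stable under left multiplication by every `T_s`, hence is
everything. -/
theorem leRight_of_repr_C_mul_ne_zero {a : Hecke L} {y v : W}
    (hv : L.basisC.repr (L.C y * a) v ≠ 0) : L.LeRight v y := by
  let N : Submodule (CoeffRing Γ) (Hecke L) :=
    Submodule.span (CoeffRing Γ) (L.C '' {w | L.LeRight w y})
  let P : Submodule (CoeffRing Γ) (Hecke L) :=
    { carrier := {a | ∀ x ∈ N, x * a ∈ N}
      zero_mem' := fun x _ => by rw [mul_zero]; exact N.zero_mem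
      add_mem' := fun ha hb x hx => by
        rw [mul_add]; exact N.add_mem (ha x hx) (hb x hx)
      smul_mem' := fun c a ha x hx => by
        rw [mul_smul_comm]; exact N.smul_mem c (ha x hx) }
  have hC : ∀ i : B, N ≤ N.comap (LinearMap.mulRight (CoeffRing Γ) (L.C (cs.simple i))) := by
    intro i
    refine Submodule.span_le.mpr ?_
    rintro _ ⟨u, hu, rfl⟩
    change L.C u * L.C (cs.simple i) ∈ N
    rw [← L.basisC.linearCombination_repr (L.C u * L.C (cs.simple i)),
      Finsupp.linearCombination_apply]
    refine N.sum_mem fun z hz => N.smul_mem _ (Submodule.subset_span ⟨z, ?_, ?_⟩)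
    · exact (Relation.ReflTransGen.single ⟨i, Finsupp.mem_support_iff.mp hz⟩).trans hu
    · rw [basisC_apply]
  have hP : P = ⊤ := by
    refine L.hecke_eq_top P (fun x hx => by rwa [mul_one]) ?_
    intro i a ha x hx
    -- Since `T_s = C_s - q_s⁻¹`, grouping `C_s` with `x` keeps `x C_s` in `N`, and `a` then
    -- preserves `N`.
    have h1 : x * (L.T (cs.simple i) * a) =
        (x * L.C (cs.simple i)) * a - L.qInv i • (x * a) := by
      rw [C_simple, mul_add, mul_smul_comm, mul_one, add_mul, smul_mul_assoc,
        add_sub_cancel_right, mul_assoc]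
    rw [h1]
    exact N.sub_mem (ha _ (hC i hx)) (N.smul_mem _ (ha x hx))
  have ha : a ∈ P := by rw [hP]; trivial
  exact L.mem_of_mem_span_C (I := {w | L.LeRight w y})
    (ha _ (Submodule.subset_span ⟨y, Relation.ReflTransGen.refl, rfl⟩)) hv

/-! ### The dual Kazhdan–Lusztig basis and the comparison of cells. -/

/-- The basis dual to the Kazhdan–Lusztig basis with respect to the trace form. -/
noncomputable def dualC [Fintype W] (z : W) : Hecke L := L.dualElement (L.basisC.coord z)

theorem traceForm_mul_dualC [Fintype W] (x : Hecke L) (z : W) :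
    L.traceForm (x * L.dualC z) = L.basisC.repr x z :=
  L.traceForm_mul_dualElement _ x

/-- The sum of dual basis elements times basis elements does not depend on the basis. Here one
expands `D_z` in the `T_{w⁻¹}`, exchanges the sums, and recognises the expansion of `T_w` in the
`C_z`. -/
theorem sum_dualC_mul_C [Fintype W] : ∑ z, L.dualC z * L.C z = ∑ w, L.T w⁻¹ * L.T w := by
  simp only [dualC, dualElement, Finset.sum_mul]
  rw [Finset.sum_comm]
  refine Finset.sum_congr rfl fun w _ => ?_
  conv_rhs => rw [← L.basisC.sum_repr (L.T w), Finset.mul_sum]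
  refine Finset.sum_congr rfl fun z _ => ?_
  rw [Module.Basis.coord_apply, basisC_apply, smul_mul_assoc, mul_smul_comm]

/-- If all these coefficients vanished, so would their sum over `z`, the coefficient of `C_x` in
`C_x ∑_w T_{w⁻¹} T_w`; yet that sum specialises to a nonzero integer. -/
theorem exists_repr_C_mul_dualC_mul_C_ne_zero [Fintype W] (x : W) :
    ∃ z, L.basisC.repr (L.C x * L.dualC z * L.C z) x ≠ 0 := by
  by_contra! h
  have h1 : L.basisC.coord x (∑ w, L.C x * (L.T w⁻¹ * L.T w)) = 0 := by
    rw [← Finset.mul_sum, ← sum_dualC_mul_C, Finset.mul_sum, map_sum]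
    refine Finset.sum_eq_zero fun z _ => ?_
    rw [Module.Basis.coord_apply, ← mul_assoc, h]
  -- After specialisation each `w` contributes the coefficient of `C_x` in `C_x`, namely `1`, so the
  -- equation reads `|W| = 0` in `ℤ`.
  have h2 := congrArg (augmentation Γ) h1
  rw [map_sum, map_sum, Finset.sum_congr rfl
    fun w _ => L.augmentation_mul_T_inv_mul_T (L.basisC.coord x) (L.C x) w,
    Module.Basis.coord_apply, ← basisC_apply, Module.Basis.repr_self, Finsupp.single_eq_same,
    map_one, map_zero] at h2
  simp at h2

/-- Pairing either side with `a` yields a coefficient of `a C_x` or `a C_y`. Both are linear in `a`,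
so it is enough to compare them for `a = C_w`, where they are the given structure constants. -/
theorem C_mul_dualC_eq [Fintype W] {x y z u : W} (h : ∀ w, L.h w x z = L.h w y u) :
    L.C x * L.dualC z = L.C y * L.dualC u := by
  refine L.eq_of_traceForm_mul_eq fun a => ?_
  rw [← mul_assoc, ← mul_assoc, traceForm_mul_dualC, traceForm_mul_dualC]
  have h1 : (L.basisC.coord z).comp (LinearMap.mulRight (CoeffRing Γ) (L.C x)) =
      (L.basisC.coord u).comp (LinearMap.mulRight (CoeffRing Γ) (L.C y)) := by
    refine L.basisC.ext fun w => ?_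
    rw [basisC_apply]
    exact h w
  exact LinearMap.congr_fun h1 a

/-- By nondegeneracy, a nonzero `C_x D_z` pairs nontrivially with some `a`, which means that `C_z`
occurs in `a C_x`. -/
theorem leLeft_of_C_mul_dualC_ne_zero [Fintype W] {x z : W} (h : L.C x * L.dualC z ≠ 0) :
    L.LeLeft z x := by
  by_contra hn
  refine h (L.eq_of_traceForm_mul_eq fun a => ?_)
  rw [← mul_assoc, traceForm_mul_dualC, mul_zero, map_zero]
  by_contra h0
  exact hn (L.leLeft_of_repr_mul_C_ne_zero h0)

variable {L} in
/-- Matching structure constants on two left cells force corresponding elements to be comparable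
in the right pre-order. -/
theorem IsLeftCell.leRight_of_h_eq [Finite W] {D D₁ : Set W} (hD : L.IsLeftCell D) (φ : D → D₁)
    (hφ : ∀ (w : W) (x y : D), L.h w x y = L.h w (φ x) (φ y)) (x : D) :
    L.LeRight (x : W) (φ x : W) := by
  have := Fintype.ofFinite W
  obtain ⟨z, hz⟩ := L.exists_repr_C_mul_dualC_mul_C_ne_zero (x : W)
  have hzx : L.LeLeft z x := by
    refine L.leLeft_of_C_mul_dualC_ne_zero fun h0 => hz ?_
    rw [h0, zero_mul, map_zero, Finsupp.zero_apply]
  have hxz : L.LeLeft x z := L.leLeft_of_repr_mul_C_ne_zero hz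
  have hzD : z ∈ D := by
    obtain ⟨d, rfl⟩ := hD
    exact ⟨hzx.trans x.2.1, x.2.2.trans hxz⟩
  -- Only `C_x D_z` is transported along `φ`. The last factor `C_z` is unchanged and is absorbed
  -- into the right multiplier of `C_{φ x}`.
  rw [L.C_mul_dualC_eq fun w => hφ w x ⟨z, hzD⟩, mul_assoc] at hz
  exact L.leRight_of_repr_C_mul_ne_zero hz

end Cells

end CoxeterSystem.WeightFunction

theorem proposition2p12 {B W Γ : Type*} [Group W] [Finite W] {M : CoxeterMatrix B}
    (cs : CoxeterSystem M W) [AddCommGroup Γ] [LinearOrder Γ] [IsOrderedAddMonoid Γ]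
    (L : cs.WeightFunction Γ) {D D₁ : Set W} (hD : L.IsLeftCell D) (hD₁ : L.IsLeftCell D₁)
    (hχ : hD.character = hD₁.character) (hirr : hD.character ∈ L.Irr)
    (φ : D ≃ D₁) (hφ : ∀ (w : W) (x y : D), L.h w x y = L.h w (φ x) (φ y)) (x : D) :
    L.SimRight (x : W) (φ x : W) := by
  refine ⟨hD.leRight_of_h_eq φ hφ x, ?_⟩
  -- The matching of structure constants is symmetric in the two cells, so the inverse bijection
  -- yields `φ x ≤_R x`.
  have h := hD₁.leRight_of_h_eq φ.symm
    (fun w y z => by rw [hφ, φ.apply_symm_apply, φ.apply_symm_apply]) (φ x)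
  rwa [φ.symm_apply_apply] at h
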